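/- Let $\mathcal C$ be a Krull–Schmidt triangulated category with suspension $\Sigma$ (every object is a finite direct sum of objects with local endomorphism rings). Let $\mathcal E$ be a proper class of triangles in $\mathcal C$ in the sense of Beligiannis: a class of distinguished triangles that contains all splitting triangles (those $A\to B\to C\xrightarrow{h}\Sigma A$ with $h=0$), is closed under isomorphisms, finite coproducts, suspensions, base change and cobase change, and is saturated, i.e. if $A\to B\to C\xrightarrow{h}\Sigma A$ is distinguished, $M\to E\xrightarrow{\varepsilon}C\to\Sigma M$ is in $\mathcal E$ and its base change $A\to G\to E\xrightarrow{h\varepsilon}\Sigma A$ is in $\mathcal E$, then $A\to B\to C\xrightarrow{h}\Sigma A$ is in $\mathcal E$. An object $P$ is *projective* if $\mathcal C(P,B)\to\mathcal C(P,C)$ is surjective for every triangle $A\to B\to C\to\Sigma A$ in $\mathcal E$; *injective* objects are defined dually. Assume that $\mathcal E$ has enough projectives and enough injectives: for each object $X$ there are triangles $K\to P\to X\to\Sigma K$ and $X\to I\to L\to\Sigma X$ in $\mathcal E$ with $P$ projective and $I$ injective. Such a $K$ is a syzygy of $X$, and $\Omega^iX$ denotes an $i$-th syzygy ($\Omega^0X=X$).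 Let $\mathbb E(C,A)$ be the set of morphisms $h\colon C\to\Sigma A$ that occur in a triangle $A\to B\to C\xrightarrow{h}\Sigma A$ of $\mathcal E$, and put $\mathbb E^{i+1}(X,Y)=\mathbb E(\Omega^iX,Y)$ for $i\ge 0$. All subcategories are full, additive and closed under isomorphisms. For a subcategory $\mathcal X$ put $$\mathcal X^{\bot}=\{Y : \mathbb E^i(X,Y)=0\ \ \forall X\in\mathcal X,\ i\ge1\},\qquad {}^{\bot}\mathcal X=\{Y : \mathbb E^i(Y,X)=0\ \ \forall X\in\mathcal X,\ i\ge1\}.$$ The projective dimension $\operatorname{pd}A\in\mathbb N\cup\{\infty\}$ is the least length $m$ of a projective resolution $P_m\to\cdots\to P_0\to A$ spliced from triangles in $\mathcal E$. For $n\ge0$, $\check{\mathcal X}_n$ consists of the objects $A$ with a sequence $A\to X_0\to\cdots\to X_n$, all $X_i\in\mathcal X$, spliced from triangles in $\mathcal E$ (so $\check{\mathcal X}_0=\mathcal X$). Fix an integer $n\ge0$. A subcategory $\mathcal T$ closed under direct summands is *tilting* if $\operatorname{pd}T\le n$ for all $T\in\mathcal T$ and $\mathcal T$ is a generator for $\mathcal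 T^{\bot}$, i.e. $\mathcal T\subseteq\mathcal T^{\bot}$ and each $Y\in\mathcal T^{\bot}$ admits a triangle $Y'\to T\to Y\to\Sigma Y'$ in $\mathcal E$ with $T\in\mathcal T$ and $Y'\in\mathcal T^{\bot}$. A subcategory $\mathcal X$ is *coresolving* if it contains all injectives and, for each triangle $A\to B\to C\to\Sigma A$ in $\mathcal E$, $A,C\in\mathcal X$ implies $B\in\mathcal X$, and $A,B\in\mathcal X$ implies $C\in\mathcal X$. It is *covariantly finite* if every object $B$ admits a morphism $B\to X_B$ with $X_B\in\mathcal X$ through which every morphism from $B$ to an object of $\mathcal X$ factors. **Theorem.** The assignments $\mathcal T\mapsto\mathcal T^{\bot}$ and $\mathcal X\mapsto{}^{\bot}\mathcal X\cap\mathcal X$ are mutually inverse bijections between the class of tilting subcategories of $\mathcal C$ and the class of coresolving covariantly finite subcategories $\mathcal X$ of $\mathcal C$ that are closed under direct summands and satisfy $\check{\mathcal X}_n=\mathcal C$. -/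

import Mathlib

open CategoryTheory CategoryTheory.Limits CategoryTheory.Pretriangulated

namespace ProperTilting

universe v u

/-- A Krull-Schmidt category: every object is a finite direct sum of objects with local
endomorphism rings. -/
def IsKrullSchmidt (C : Type u) [Category.{v} C] [Preadditive C] [HasFiniteBiproducts C] : Prop :=
  ∀ X : C, ∃ (m : ℕ) (Y : Fin m → C),
    (∀ i, IsLocalRing (End (Y i))) ∧ Nonempty (X ≅ ⨁ Y)

variable {C : Type u} [Category.{v} C] [Preadditive C] [HasZeroObject C] [HasShift C ℤ]
  [∀ n : ℤ, (shiftFunctor C n).Additive] [Pretriangulated C]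

/-- The direct sum of two triangles, formed termwise. -/
noncomputable def directSum (T T' : Triangle C) : Triangle C :=
  Triangle.mk (biprod.map T.mor₁ T'.mor₁) (biprod.map T.mor₂ T'.mor₂)
    (biprod.desc (T.mor₃ ≫ biprod.inl⟦(1 : ℤ)⟧') (T'.mor₃ ≫ biprod.inr⟦(1 : ℤ)⟧'))

/-- A proper class of triangles in a triangulated category, in the sense of Beligiannis. -/
structure IsProperClass (E : Set (Triangle C)) : Prop where
  /-- all members are distinguished triangles -/
  distinguished : E ⊆ distTriang C
  /-- all splitting triangles are members -/
  split : ∀ T ∈ distTriang C, T.mor₃ = 0 → T ∈ E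
  /-- closed under isomorphisms of triangles -/
  iso : ∀ {T T' : Triangle C}, (T ≅ T') → T ∈ E → T' ∈ E
  /-- closed under finite coproducts (the empty one, the zero triangle, is a splitting triangle) -/
  coprod : ∀ {T T' : Triangle C}, T ∈ E → T' ∈ E → directSum T T' ∈ E
  /-- closed under suspensions; `Triangle.shiftFunctor C i` applies the `i`-th power of the
  suspension and multiplies the three morphisms by `(-1) ^ i` -/
  suspension : ∀ {T : Triangle C}, T ∈ E → ∀ i : ℤ, (Triangle.shiftFunctor C i).obj T ∈ E
  /-- closed under base change -/
  baseChange : ∀ {A B X Y G : C} {f : A ⟶ B} {g : B ⟶ X} {h : X ⟶ A⟦(1 : ℤ)⟧} (ε : Y ⟶ X)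
    {f' : A ⟶ G} {g' : G ⟶ Y}, Triangle.mk f g h ∈ E →
    Triangle.mk f' g' (ε ≫ h) ∈ distTriang C → Triangle.mk f' g' (ε ≫ h) ∈ E
  /-- closed under cobase change -/
  cobaseChange : ∀ {A B X D F : C} {f : A ⟶ B} {g : B ⟶ X} {h : X ⟶ A⟦(1 : ℤ)⟧} (α : A ⟶ D)
    {f' : D ⟶ F} {g' : F ⟶ X}, Triangle.mk f g h ∈ E →
    Triangle.mk f' g' (h ≫ α⟦(1 : ℤ)⟧') ∈ distTriang C →
    Triangle.mk f' g' (h ≫ α⟦(1 : ℤ)⟧') ∈ E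
  /-- saturated: if the base change of a distinguished triangle along `ε` is in the class, and
  some triangle `M ⟶ Y ⟶ X ⟶ M⟦1⟧` on `ε` is in the class, then so is the given triangle -/
  saturated : ∀ {A B X Y G M : C} {f : A ⟶ B} {g : B ⟶ X} {h : X ⟶ A⟦(1 : ℤ)⟧} {ε : Y ⟶ X}
    {f' : A ⟶ G} {g' : G ⟶ Y} {δ : M ⟶ Y} {ζ : X ⟶ M⟦(1 : ℤ)⟧},
    Triangle.mk f g h ∈ distTriang C →
    Triangle.mk δ ε ζ ∈ E → Triangle.mk f' g' (ε ≫ h) ∈ E → Triangle.mk f g h ∈ E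

section Relative

variable (E : Set (Triangle C))

/-- `A ⟶ B ⟶ X` is a conflation, that is, it is completed by some `h` to a triangle in `E`. -/
def IsConflation {A B X : C} (f : A ⟶ B) (g : B ⟶ X) : Prop :=
  ∃ h : X ⟶ A⟦(1 : ℤ)⟧, Triangle.mk f g h ∈ E

/-- The set of `E`-phantom maps from `X` to `A⟦1⟧`, written `𝔼(X, A)`. -/
def phantom (X A : C) : Set (X ⟶ A⟦(1 : ℤ)⟧) :=
  {h | ∃ (B : C) (f : A ⟶ B) (g : B ⟶ X), Triangle.mk f g h ∈ E}

/-- The `E`-projective objects. -/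
def proj : ObjectProperty C := fun P =>
  ∀ ⦃A B X : C⦄ (f : A ⟶ B) (g : B ⟶ X), IsConflation E f g →
    ∀ c : P ⟶ X, ∃ b : P ⟶ B, b ≫ g = c

/-- The `E`-injective objects. -/
def inj : ObjectProperty C := fun I =>
  ∀ ⦃A B X : C⦄ (f : A ⟶ B) (g : B ⟶ X), IsConflation E f g →
    ∀ a : A ⟶ I, ∃ b : B ⟶ I, f ≫ b = a

def EnoughProj : Prop :=
  ∀ X : C, ∃ (K P : C) (f : K ⟶ P) (g : P ⟶ X), proj E P ∧ IsConflation E f g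

def EnoughInj : Prop :=
  ∀ A : C, ∃ (I L : C) (f : A ⟶ I) (g : I ⟶ L), inj E I ∧ IsConflation E f g

/-- `IsSyzygy E i X Z` says that `Z` is an `i`-th syzygy of `X`. -/
inductive IsSyzygy : ℕ → C → C → Prop
  | zero (X : C) : IsSyzygy 0 X X
  | succ {i : ℕ} {X W Z P : C} (f : Z ⟶ P) (g : P ⟶ W) :
      IsSyzygy i X W → proj E P → IsConflation E f g → IsSyzygy (i + 1) X Z

/-- `ExtVanish E i X Y` says that the higher extension group
`𝔼^(i+1)(X, Y) = 𝔼(Z, Y)`, with `Z` an `i`-th syzygy of `X`, is zero.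
Up to isomorphism this group does not depend on the choice of `Z`; here all choices are used. -/
def ExtVanish (i : ℕ) (X Y : C) : Prop :=
  ∀ Z : C, IsSyzygy E i X Z → phantom E Z Y = {0}

/-- The right orthogonal: all `Y` with `𝔼^i(X, Y) = 0` for all `X` in the subcategory, `i ≥ 1`. -/
def rightPerp (𝒳 : ObjectProperty C) : ObjectProperty C := fun Y =>
  ∀ X, 𝒳 X → ∀ i : ℕ, ExtVanish E i X Y

/-- The left orthogonal: all `Y` with `𝔼^i(Y, X) = 0` for all `X` in the subcategory, `i ≥ 1`. -/
def leftPerp (𝒳 : ObjectProperty C) : ObjectProperty C := fun Y =>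
  ∀ X, 𝒳 X → ∀ i : ℕ, ExtVanish E i Y X

/-- `HasProjResolution E m A` says that `A` has a projective resolution of length `m`,
`P_m ⟶ ⋯ ⟶ P_0 ⟶ A`, spliced from triangles in `E`. -/
inductive HasProjResolution : ℕ → C → Prop
  | zero {A : C} : proj E A → HasProjResolution 0 A
  | succ {m : ℕ} {A K P : C} (f : K ⟶ P) (g : P ⟶ A) :
      proj E P → IsConflation E f g → HasProjResolution m K → HasProjResolution (m + 1) A

/-- The projective dimension, which is `⊤` if there is no projective resolution of finite
length. -/
noncomputable def projDim (A : C) : ℕ∞ :=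
  ⨅ (m : ℕ) (_ : HasProjResolution E m A), (m : ℕ∞)

/-- `coresolved E 𝒳 n` consists of the objects `A` with a sequence
`A ⟶ X_0 ⟶ ⋯ ⟶ X_n`, all `X_i` in `𝒳`, spliced from triangles in `E`. -/
def coresolved (𝒳 : ObjectProperty C) : ℕ → ObjectProperty C
  | 0 => 𝒳
  | n + 1 => fun A => ∃ (X L : C) (f : A ⟶ X) (g : X ⟶ L),
      𝒳 X ∧ IsConflation E f g ∧ coresolved 𝒳 n L

/-- `𝒯` is a generator for `𝒴`. -/
def IsGenerator (𝒯 𝒴 : ObjectProperty C) : Prop :=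
  𝒯 ≤ 𝒴 ∧ ∀ Y, 𝒴 Y → ∃ (Y' T : C) (f : Y' ⟶ T) (g : T ⟶ Y),
    𝒯 T ∧ 𝒴 Y' ∧ IsConflation E f g

/-- Full additive subcategories closed under isomorphisms. -/
structure IsAdditiveSubcategory (𝒳 : ObjectProperty C) : Prop where
  iso : 𝒳.IsClosedUnderIsomorphisms
  zero : 𝒳.ContainsZero
  biprod : ∀ X Y : C, 𝒳 X → 𝒳 Y → 𝒳 (X ⊞ Y)

/-- Closed under direct summands. -/
def ClosedUnderSummands (𝒳 : ObjectProperty C) : Prop :=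
  ∀ X Y : C, 𝒳 (X ⊞ Y) → 𝒳 X

/-- Every object has a left `𝒳`-approximation. -/
def IsCovariantlyFinite (𝒳 : ObjectProperty C) : Prop :=
  ∀ B : C, ∃ (X₀ : C) (g : B ⟶ X₀), 𝒳 X₀ ∧
    ∀ X, 𝒳 X → ∀ h : B ⟶ X, ∃ k : X₀ ⟶ X, g ≫ k = h

/-- Coresolving: contains the injectives, and is closed under extensions and cones of
inflations. -/
structure IsCoresolving (𝒳 : ObjectProperty C) : Prop where
  inj_le : inj E ≤ 𝒳
  ext : ∀ {A B X : C} (f : A ⟶ B) (g : B ⟶ X), IsConflation E f g → 𝒳 A → 𝒳 X → 𝒳 B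
  cone : ∀ {A B X : C} (f : A ⟶ B) (g : B ⟶ X), IsConflation E f g → 𝒳 A → 𝒳 B → 𝒳 X

/-- Tilting subcategories (of projective dimension at most `n`). -/
structure IsTilting (n : ℕ) (𝒯 : ObjectProperty C) : Prop where
  additive : IsAdditiveSubcategory 𝒯
  summands : ClosedUnderSummands 𝒯
  projDim_le : ∀ T, 𝒯 T → projDim E T ≤ n
  generator : IsGenerator E 𝒯 (rightPerp E 𝒯)

/-- The coresolving covariantly finite subcategories `𝒳`, closed under direct summands, such
that every object has a coresolution of length `n` by `𝒳`. -/
structure IsCoresolvingCovFinite (n : ℕ) (𝒳 : ObjectProperty C) : Prop where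
  additive : IsAdditiveSubcategory 𝒳
  coresolving : IsCoresolving E 𝒳
  covFinite : IsCovariantlyFinite 𝒳
  summands : ClosedUnderSummands 𝒳
  coresolved_eq : coresolved E 𝒳 n = ⊤

end Relative

end ProperTilting

/-! A map is `E`-phantom exactly when every map from a projective kills it, and dually exactly when
every map into an injective does. This supplies the exact-sequence arguments and the dimension shift
in both variables, and only the vanishing of extensions is ever needed.

If `𝒯` is tilting, projective dimension at most `n` forces the `n`-th cosyzygy of any object into `𝒳
= rightPerp 𝒯`, so injectives give the coresolution (`coresolved_rightPerp`). Since `𝒯` generates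
`𝒳`, the Auslander-Buchweitz construction (`exists_approx_of_coresolved`) turns it into triangles `A
⟶ U ⟶ W` with `U` in `𝒳` and `W` in `leftPerp 𝒳`; hence `𝒳` is covariantly finite.

If `𝒳` is a coresolving class as in the theorem, Wakamatsu's lemma for minimal approximations
(`hasSpecialApprox_of_covariantlyFinite`) gives the same triangles; this is where Krull-Schmidt
enters. The coresolutions of length `n` bound projective dimensions on `leftPerp 𝒳`, and iterating
the triangles resolves such `W` by `𝒯 = leftPerp 𝒳 ⊓ 𝒳` (`HasSpecialApprox.coresolved_of_leftPerp`).

Both inverse identities then follow by splitting a triangle whose extension class vanishes and using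
closure under summands. -/

namespace ProperTilting

universe v u

variable {C : Type u} [Category.{v} C] [Preadditive C] [HasZeroObject C] [HasShift C ℤ]
  [∀ n : ℤ, (shiftFunctor C n).Additive] [Pretriangulated C]

/-! ### Lifting and extending maps along a distinguished triangle. -/

section Exactness

variable {A B X W : C} {f : A ⟶ B} {g : B ⟶ X} {h : X ⟶ A⟦(1 : ℤ)⟧}

lemma dist_lift₃ (hT : Triangle.mk f g h ∈ distTriang C) (c : W ⟶ X) (hc : c ≫ h = 0) :
    ∃ b : W ⟶ B, b ≫ g = c := by
  obtain ⟨a, ha⟩ := Triangle.coyoneda_exact₃ _ hT c hc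
  exact ⟨a, ha.symm⟩

lemma dist_lift₁_shift (hT : Triangle.mk f g h ∈ distTriang C) (c : W ⟶ A⟦(1 : ℤ)⟧)
    (hc : c ≫ f⟦(1 : ℤ)⟧' = 0) : ∃ x : W ⟶ X, x ≫ h = c := by
  obtain ⟨a, ha⟩ := Triangle.coyoneda_exact₁ _ hT c hc
  exact ⟨a, ha.symm⟩

lemma dist_lift₂_shift (hT : Triangle.mk f g h ∈ distTriang C) (c : W ⟶ B⟦(1 : ℤ)⟧)
    (hc : c ≫ g⟦(1 : ℤ)⟧' = 0) : ∃ a : W ⟶ A⟦(1 : ℤ)⟧, a ≫ f⟦(1 : ℤ)⟧' = c := by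
  obtain ⟨a, ha⟩ := Triangle.coyoneda_exact₁ _ (rot_of_distTriang _ hT) c hc
  have ha' : c = (show W ⟶ A⟦(1 : ℤ)⟧ from a) ≫ (-f⟦(1 : ℤ)⟧') := ha
  exact ⟨-(show W ⟶ A⟦(1 : ℤ)⟧ from a), by
    rw [Preadditive.neg_comp, ← Preadditive.comp_neg, ← ha']⟩

lemma dist_desc₂ (hT : Triangle.mk f g h ∈ distTriang C) (c : B ⟶ W) (hc : f ≫ c = 0) :
    ∃ x : X ⟶ W, g ≫ x = c := by
  obtain ⟨a, ha⟩ := Triangle.yoneda_exact₂ _ hT c hc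
  exact ⟨a, ha.symm⟩

lemma dist_desc₃ (hT : Triangle.mk f g h ∈ distTriang C) (c : X ⟶ W⟦(1 : ℤ)⟧)
    (hc : g ≫ c = 0) : ∃ a : A ⟶ W, h ≫ a⟦(1 : ℤ)⟧' = c := by
  obtain ⟨a, ha⟩ := Triangle.yoneda_exact₃ _ hT c hc
  obtain ⟨b, rfl⟩ := (shiftFunctor C (1 : ℤ)).map_surjective a
  exact ⟨b, ha.symm⟩

lemma dist_desc₁ (hT : Triangle.mk f g h ∈ distTriang C) (c : A ⟶ W)
    (hc : h ≫ c⟦(1 : ℤ)⟧' = 0) : ∃ b : B ⟶ W, f ≫ b = c := by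
  obtain ⟨a, ha⟩ := Triangle.yoneda_exact₃ _ (rot_of_distTriang _ hT) (c⟦(1 : ℤ)⟧') hc
  obtain ⟨b, rfl⟩ := (shiftFunctor C (1 : ℤ)).map_surjective (X := B) a
  -- The rotated triangle carries `-f⟦1⟧'`, hence the sign.
  refine ⟨-b, (shiftFunctor C (1 : ℤ)).map_injective ?_⟩
  rw [Functor.map_comp, Functor.map_neg, Preadditive.comp_neg, ← Preadditive.neg_comp]
  exact ha.symm

end Exactness

/-- The running assumptions on a class of triangles. -/
structure IsProperWithEnough (E : Set (Triangle C)) : Prop where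
  proper : IsProperClass E
  enoughProj : EnoughProj E
  enoughInj : EnoughInj E

variable {E : Set (Triangle C)}

/-! ### Phantom maps and their detection by projectives and injectives. -/

section Phantom

/-- Base change along the identity shows that membership in `E` of a distinguished triangle depends
only on its third morphism. -/
lemma mem_of_mem_phantom (hE : IsProperClass E) {A B X : C} {f : A ⟶ B} {g : B ⟶ X}
    {h : X ⟶ A⟦(1 : ℤ)⟧} (hT : Triangle.mk f g h ∈ distTriang C) (hh : h ∈ phantom E X A) :
    Triangle.mk f g h ∈ E := by
  obtain ⟨B', f', g', hm⟩ := hh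
  have := hE.baseChange (𝟙 X) (f' := f) (g' := g) hm
  rw [Category.id_comp] at this
  exact this hT

omit [Preadditive C] [HasZeroObject C] [∀ n : ℤ, (shiftFunctor C n).Additive]
  [Pretriangulated C] in
lemma phantom_of_mem {A B X : C} {f : A ⟶ B} {g : B ⟶ X}
    {h : X ⟶ A⟦(1 : ℤ)⟧} (hT : Triangle.mk f g h ∈ E) : h ∈ phantom E X A := ⟨B, f, g, hT⟩

lemma comp_mem_phantom (hE : IsProperClass E) {X Y A : C} (ε : Y ⟶ X) {h : X ⟶ A⟦(1 : ℤ)⟧}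
    (hh : h ∈ phantom E X A) : ε ≫ h ∈ phantom E Y A := by
  obtain ⟨B, f, g, hm⟩ := hh
  obtain ⟨Z, f', g', hT⟩ := distinguished_cocone_triangle₂ (ε ≫ h)
  exact ⟨Z, f', g', hE.baseChange ε hm hT⟩

lemma comp_shift_mem_phantom (hE : IsProperClass E) {X A D : C} {h : X ⟶ A⟦(1 : ℤ)⟧}
    (hh : h ∈ phantom E X A) (α : A ⟶ D) : h ≫ α⟦(1 : ℤ)⟧' ∈ phantom E X D := by
  obtain ⟨B, f, g, hm⟩ := hh
  obtain ⟨Z, f', g', hT⟩ := distinguished_cocone_triangle₂ (h ≫ α⟦(1 : ℤ)⟧')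
  exact ⟨Z, f', g', hE.cobaseChange α hm hT⟩

lemma zero_mem_phantom (hE : IsProperClass E) (X A : C) :
    (0 : X ⟶ A⟦(1 : ℤ)⟧) ∈ phantom E X A := by
  obtain ⟨Z, f', g', hT⟩ := distinguished_cocone_triangle₂ (0 : X ⟶ A⟦(1 : ℤ)⟧)
  exact ⟨Z, f', g', hE.split _ hT rfl⟩

lemma proj_comp_phantom (hE : IsProperClass E) {P X A : C} (hP : proj E P) (p : P ⟶ X)
    {h : X ⟶ A⟦(1 : ℤ)⟧} (hh : h ∈ phantom E X A) : p ≫ h = 0 := by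
  obtain ⟨B, f, g, hm⟩ := hh
  obtain ⟨b, rfl⟩ := hP f g ⟨h, hm⟩ p
  have : g ≫ h = 0 := comp_distTriang_mor_zero₂₃ _ (hE.distinguished hm)
  rw [Category.assoc, this, comp_zero]

lemma phantom_comp_inj (hE : IsProperClass E) {I X A : C} (hI : inj E I) (j : A ⟶ I)
    {h : X ⟶ A⟦(1 : ℤ)⟧} (hh : h ∈ phantom E X A) : h ≫ j⟦(1 : ℤ)⟧' = 0 := by
  obtain ⟨B, f, g, hm⟩ := hh
  obtain ⟨b, rfl⟩ := hI f g ⟨h, hm⟩ j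
  have : h ≫ f⟦(1 : ℤ)⟧' = 0 := comp_distTriang_mor_zero₃₁ _ (hE.distinguished hm)
  rw [Functor.map_comp, ← Category.assoc, this, zero_comp]

/-- A map killed by one projective deflation `P ⟶ X` factors through the connecting map of that
triangle, so it comes from a cobase change. -/
lemma mem_phantom_of_proj (hE : IsProperWithEnough E) {X A : C} {h : X ⟶ A⟦(1 : ℤ)⟧}
    (H : ∀ P, proj E P → ∀ p : P ⟶ X, p ≫ h = 0) : h ∈ phantom E X A := by
  obtain ⟨K, P, f, g, hP, k, hm⟩ := hE.enoughProj X
  obtain ⟨a, rfl⟩ := dist_desc₃ (hE.proper.distinguished hm) h (H P hP g)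
  exact comp_shift_mem_phantom hE.proper (phantom_of_mem hm) a

lemma mem_phantom_of_inj (hE : IsProperWithEnough E) {X A : C} {h : X ⟶ A⟦(1 : ℤ)⟧}
    (H : ∀ I, inj E I → ∀ j : A ⟶ I, h ≫ j⟦(1 : ℤ)⟧' = 0) : h ∈ phantom E X A := by
  obtain ⟨I, L, f, g, hI, k, hm⟩ := hE.enoughInj A
  obtain ⟨a, rfl⟩ := dist_lift₁_shift (hE.proper.distinguished hm) h (H I hI f)
  exact comp_mem_phantom hE.proper a (phantom_of_mem hm)

lemma neg_mem_phantom (hE : IsProperWithEnough E) {X A : C} {h : X ⟶ A⟦(1 : ℤ)⟧}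
    (hh : h ∈ phantom E X A) : -h ∈ phantom E X A :=
  mem_phantom_of_proj hE fun P hP p => by simp [proj_comp_phantom hE.proper hP p hh]

/-- Phantomness can be tested after precomposition with a deflation. -/
lemma mem_phantom_of_deflation_comp (hE : IsProperWithEnough E) {A B X Y : C} {f : A ⟶ B}
    {g : B ⟶ X} (hc : IsConflation E f g) {h : X ⟶ Y⟦(1 : ℤ)⟧}
    (hh : g ≫ h ∈ phantom E B Y) : h ∈ phantom E X Y :=
  mem_phantom_of_proj hE fun P hP p => by
    obtain ⟨b, rfl⟩ := hP f g hc p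
    rw [Category.assoc]
    exact proj_comp_phantom hE.proper hP b hh

/-- Phantomness can be tested after postcomposition with an inflation. -/
lemma mem_phantom_of_comp_inflation (hE : IsProperWithEnough E) {A B X Y : C} {f : A ⟶ B}
    {g : B ⟶ X} (hc : IsConflation E f g) {h : Y ⟶ A⟦(1 : ℤ)⟧}
    (hh : h ≫ f⟦(1 : ℤ)⟧' ∈ phantom E Y B) : h ∈ phantom E Y A :=
  mem_phantom_of_inj hE fun I hI j => by
    obtain ⟨b, rfl⟩ := hI f g hc j
    rw [Functor.map_comp, ← Category.assoc]
    exact phantom_comp_inj hE.proper hI b hh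

end Phantom

/-! ### Vanishing of first extensions along conflations. -/

section Vanishing

variable (E) in
/-- `𝔼(X, Y) = 0`. -/
def PhantomVanish (X Y : C) : Prop := ∀ h ∈ phantom E X Y, h = 0

lemma phantom_eq_zero_iff (hE : IsProperClass E) {X Y : C} :
    phantom E X Y = {0} ↔ PhantomVanish E X Y := by
  constructor
  · intro h x hx
    rw [h] at hx
    exact hx
  · intro h
    exact Set.Subset.antisymm h (Set.singleton_subset_iff.2 (zero_mem_phantom hE X Y))

lemma PhantomVanish.of_proj (hE : IsProperClass E) {P : C} (hP : proj E P) (Y : C) :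
    PhantomVanish E P Y := fun h hh => by
  simpa using proj_comp_phantom hE hP (𝟙 P) hh

lemma PhantomVanish.of_inj (hE : IsProperClass E) {I : C} (hI : inj E I) (X : C) :
    PhantomVanish E X I := fun h hh => by
  simpa using phantom_comp_inj hE hI (𝟙 I) hh

lemma PhantomVanish.of_retract_left (hE : IsProperClass E) {X X' Y : C} (i : X' ⟶ X) (r : X ⟶ X')
    (hir : i ≫ r = 𝟙 X') (H : PhantomVanish E X Y) : PhantomVanish E X' Y := fun h hh => by
  have := H _ (comp_mem_phantom hE r hh)
  rw [← Category.id_comp h, ← hir, Category.assoc, this, comp_zero]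

lemma PhantomVanish.of_retract_right (hE : IsProperClass E) {X Y Y' : C} (i : Y' ⟶ Y)
    (r : Y ⟶ Y') (hir : i ≫ r = 𝟙 Y') (H : PhantomVanish E X Y) : PhantomVanish E X Y' :=
  fun h hh => by
    have := H _ (comp_shift_mem_phantom hE hh i)
    rw [← Category.comp_id h, ← (shiftFunctor C (1 : ℤ)).map_id Y', ← hir, Functor.map_comp,
      ← Category.assoc, this, zero_comp]

variable {A B X : C} {f : A ⟶ B} {g : B ⟶ X}

lemma PhantomVanish.middle_left (hE : IsProperWithEnough E) (hc : IsConflation E f g) {Y : C}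
    (hA : PhantomVanish E A Y) (hX : PhantomVanish E X Y) : PhantomVanish E B Y := fun h hh => by
  obtain ⟨δ, hm⟩ := hc
  obtain ⟨x, rfl⟩ := dist_desc₂ (hE.proper.distinguished hm) h
    (hA _ (comp_mem_phantom hE.proper f hh))
  rw [hX x (mem_phantom_of_deflation_comp hE ⟨δ, hm⟩ hh), comp_zero]

lemma PhantomVanish.middle_right (hE : IsProperWithEnough E) (hc : IsConflation E f g) {Y : C}
    (hA : PhantomVanish E Y A) (hX : PhantomVanish E Y X) : PhantomVanish E Y B := fun h hh => by
  obtain ⟨δ, hm⟩ := hc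
  obtain ⟨x, rfl⟩ := dist_lift₂_shift (hE.proper.distinguished hm) h
    (hX _ (comp_shift_mem_phantom hE.proper hh g))
  rw [hA x (mem_phantom_of_comp_inflation hE ⟨δ, hm⟩ hh), zero_comp]

/-- Exactness of `𝔼(B, Y) → 𝔼(A, Y) → 𝔼(X, L)`, for `L` a cosyzygy of `Y`. -/
lemma PhantomVanish.cocone_left (hE : IsProperWithEnough E) (hc : IsConflation E f g)
    {Y I L : C} {i : Y ⟶ I} {q : I ⟶ L} (hI : inj E I) (hq : IsConflation E i q)
    (hB : PhantomVanish E B Y) (hX : PhantomVanish E X L) : PhantomVanish E A Y := fun h hh => by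
  obtain ⟨δ, hm⟩ := hc
  obtain ⟨l, hl⟩ := hq
  obtain ⟨k, rfl⟩ := dist_lift₁_shift (hE.proper.distinguished hl) h
    (phantom_comp_inj hE.proper hI i hh)
  obtain ⟨k, rfl⟩ := dist_desc₁ (hE.proper.distinguished hm) k
    (hX _ (comp_shift_mem_phantom hE.proper (phantom_of_mem hm) k))
  rw [Category.assoc, hB _ (comp_mem_phantom hE.proper k (phantom_of_mem hl)), comp_zero]

/-- Exactness of `𝔼(Z, B) → 𝔼(Z, X) → 𝔼(K, A)`, for `K` a syzygy of `Z`. -/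
lemma PhantomVanish.cone_right (hE : IsProperWithEnough E) (hc : IsConflation E f g)
    {Z P K : C} {i : K ⟶ P} {q : P ⟶ Z} (hP : proj E P) (hq : IsConflation E i q)
    (hB : PhantomVanish E Z B) (hA : PhantomVanish E K A) : PhantomVanish E Z X := fun h hh => by
  obtain ⟨δ, hm⟩ := hc
  obtain ⟨l, hl⟩ := hq
  obtain ⟨k, rfl⟩ := dist_desc₃ (hE.proper.distinguished hl) h
    (proj_comp_phantom hE.proper hP q hh)
  obtain ⟨k, rfl⟩ := dist_lift₃ (hE.proper.distinguished hm) k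
    (hA _ (comp_mem_phantom hE.proper k (phantom_of_mem hm)))
  rw [Functor.map_comp, ← Category.assoc,
    hB _ (comp_shift_mem_phantom hE.proper (phantom_of_mem hl) k), zero_comp]

/-- Exactness of `𝔼(Z, X) → 𝔼(K, A) → 𝔼(K, B)`, for `K` a syzygy of `Z`. -/
lemma PhantomVanish.cocone_right (hE : IsProperWithEnough E) (hc : IsConflation E f g)
    {Z P K : C} {i : K ⟶ P} {q : P ⟶ Z} (hP : proj E P) (hq : IsConflation E i q)
    (hX : PhantomVanish E Z X) (hB : PhantomVanish E K B) : PhantomVanish E K A := fun h hh => by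
  obtain ⟨δ, hm⟩ := hc
  obtain ⟨l, hl⟩ := hq
  obtain ⟨k, rfl⟩ := dist_lift₁_shift (hE.proper.distinguished hm) h
    (hB _ (comp_shift_mem_phantom hE.proper hh f))
  obtain ⟨k, rfl⟩ := dist_desc₁ (hE.proper.distinguished hl) k
    (hX _ (comp_shift_mem_phantom hE.proper (phantom_of_mem hl) k))
  rw [Category.assoc, proj_comp_phantom hE.proper hP k (phantom_of_mem hm), comp_zero]

/-- `𝔼(ΩX, Y) = 0` if and only if `𝔼(X, ℧Y) = 0`. -/
lemma PhantomVanish.syzygy_iff_cosyzygy (hE : IsProperWithEnough E)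
    {Z P K : C} {i : K ⟶ P} {q : P ⟶ Z} (hP : proj E P) (hq : IsConflation E i q)
    {Y I L : C} {j : Y ⟶ I} {r : I ⟶ L} (hI : inj E I) (hr : IsConflation E j r) :
    PhantomVanish E K Y ↔ PhantomVanish E Z L :=
  ⟨fun h => cone_right hE hr hP hq (of_inj hE.proper hI Z) h,
    fun h => cocone_left hE hq hI hr (of_proj hE.proper hP Y) h⟩

end Vanishing

/-! ### Higher extensions, dimension shift and projective dimension. -/

section Ext

omit [Preadditive C] [HasZeroObject C] [∀ n : ℤ, (shiftFunctor C n).Additive]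
  [Pretriangulated C] in
lemma isSyzygy_zero_iff {X Z : C} : IsSyzygy E 0 X Z ↔ Z = X :=
  ⟨fun h => by cases h; rfl, fun h => h ▸ IsSyzygy.zero _⟩

lemma extVanish_iff (hE : IsProperClass E) {i : ℕ} {X Y : C} :
    ExtVanish E i X Y ↔ ∀ Z, IsSyzygy E i X Z → PhantomVanish E Z Y := by
  simp only [ExtVanish, phantom_eq_zero_iff hE]

lemma extVanish_zero_iff (hE : IsProperClass E) {X Y : C} :
    ExtVanish E 0 X Y ↔ PhantomVanish E X Y := by
  simp [extVanish_iff hE, isSyzygy_zero_iff]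

lemma extVanish_succ_iff_cosyzygy (hE : IsProperWithEnough E) {n : ℕ} (X : C)
    {Y I L : C} {j : Y ⟶ I} {r : I ⟶ L} (hI : inj E I) (hr : IsConflation E j r) :
    ExtVanish E (n + 1) X Y ↔ ExtVanish E n X L := by
  simp only [extVanish_iff hE.proper]
  constructor
  · intro H Z hZ
    obtain ⟨K, P, f, g, hP, hc⟩ := hE.enoughProj Z
    exact (PhantomVanish.syzygy_iff_cosyzygy hE hP hc hI hr).1 (H K (.succ f g hZ hP hc))
  · rintro H K (_ | ⟨f, g, hZ, hP, hc⟩)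
    exact (PhantomVanish.syzygy_iff_cosyzygy hE hP hc hI hr).2 (H _ hZ)

/-- Higher extensions out of `X` are extensions by an iterated cosyzygy. -/
lemma exists_cosyzygy (hE : IsProperWithEnough E) (n : ℕ) (Y : C) :
    ∃ L : C, (∀ X, ExtVanish E n X Y ↔ PhantomVanish E X L) ∧
      ∀ m X, ExtVanish E (m + n) X Y ↔ ExtVanish E m X L := by
  induction n generalizing Y with
  | zero => exact ⟨Y, fun X => extVanish_zero_iff hE.proper, fun m X => Iff.rfl⟩
  | succ n ih =>
    obtain ⟨I, L, f, g, hI, hc⟩ := hE.enoughInj Y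
    obtain ⟨L', h₁, h₂⟩ := ih L
    exact ⟨L', fun X => (extVanish_succ_iff_cosyzygy hE X hI hc).trans (h₁ X),
      fun m X => (extVanish_succ_iff_cosyzygy hE (n := m + n) X hI hc).trans (h₂ m X)⟩

/-- `IsSyzygy` adds syzygies at the far end, whereas here the first one is split off. Trading the
other `n` steps for cosyzygies of `Y` leaves a single syzygy step. -/
lemma extVanish_succ_iff_syzygy (hE : IsProperWithEnough E) {n : ℕ} {Z P K : C} {i : K ⟶ P}
    {q : P ⟶ Z} (hP : proj E P) (hq : IsConflation E i q) (Y : C) :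
    ExtVanish E (n + 1) Z Y ↔ ExtVanish E n K Y := by
  obtain ⟨L, h₁, h₂⟩ := exists_cosyzygy hE n Y
  rw [h₁, add_comm, h₂]
  obtain ⟨I, L', f, g, hI, hc⟩ := hE.enoughInj L
  rw [← zero_add 1, extVanish_succ_iff_cosyzygy hE Z hI hc, extVanish_zero_iff hE.proper,
    PhantomVanish.syzygy_iff_cosyzygy hE hP hq hI hc]

lemma ExtVanish.of_proj (hE : IsProperWithEnough E) {P : C} (hP : proj E P) (n : ℕ) (Y : C) :
    ExtVanish E n P Y := by
  obtain ⟨L, h₁, -⟩ := exists_cosyzygy hE n Y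
  exact (h₁ P).2 (.of_proj hE.proper hP L)

lemma ExtVanish.of_inj (hE : IsProperWithEnough E) {I : C} (hI : inj E I) (n : ℕ) (X : C) :
    ExtVanish E n X I :=
  (extVanish_iff hE.proper).2 fun Z _ => .of_inj hE.proper hI Z

lemma ExtVanish.of_retract_left (hE : IsProperWithEnough E) {n : ℕ} {X X' Y : C} (i : X' ⟶ X)
    (r : X ⟶ X') (hir : i ≫ r = 𝟙 X') (H : ExtVanish E n X Y) : ExtVanish E n X' Y := by
  obtain ⟨L, h₁, -⟩ := exists_cosyzygy hE n Y
  rw [h₁] at H ⊢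
  exact H.of_retract_left hE.proper i r hir

lemma ExtVanish.of_retract_right (hE : IsProperWithEnough E) {n : ℕ} {X Y Y' : C} (i : Y' ⟶ Y)
    (r : Y ⟶ Y') (hir : i ≫ r = 𝟙 Y') (H : ExtVanish E n X Y) : ExtVanish E n X Y' := by
  rw [extVanish_iff hE.proper] at H ⊢
  exact fun Z hZ => (H Z hZ).of_retract_right hE.proper i r hir

variable {A B X : C} {f : A ⟶ B} {g : B ⟶ X}

lemma ExtVanish.middle_left (hE : IsProperWithEnough E) (hc : IsConflation E f g) {n : ℕ} {Y : C}
    (hA : ExtVanish E n A Y) (hX : ExtVanish E n X Y) : ExtVanish E n B Y := by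
  obtain ⟨L, h₁, -⟩ := exists_cosyzygy hE n Y
  rw [h₁] at *
  exact .middle_left hE hc hA hX

lemma ExtVanish.middle_right (hE : IsProperWithEnough E) (hc : IsConflation E f g) {n : ℕ} {Y : C}
    (hA : ExtVanish E n Y A) (hX : ExtVanish E n Y X) : ExtVanish E n Y B := by
  rw [extVanish_iff hE.proper] at *
  exact fun Z hZ => .middle_right hE hc (hA Z hZ) (hX Z hZ)

lemma ExtVanish.cocone_left (hE : IsProperWithEnough E) (hc : IsConflation E f g) {n : ℕ} {Y : C}
    (hB : ExtVanish E n B Y) (hX : ExtVanish E (n + 1) X Y) : ExtVanish E n A Y := by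
  obtain ⟨L, h₁, h₂⟩ := exists_cosyzygy hE n Y
  obtain ⟨I, L', f, g, hI, hc'⟩ := hE.enoughInj L
  rw [add_comm, h₂, ← zero_add 1, extVanish_succ_iff_cosyzygy hE X hI hc',
    extVanish_zero_iff hE.proper] at hX
  rw [h₁] at *
  exact .cocone_left hE hc hI hc' hB hX

lemma ExtVanish.cone_right (hE : IsProperWithEnough E) (hc : IsConflation E f g) {n : ℕ} {Y : C}
    (hB : ExtVanish E n Y B) (hA : ExtVanish E (n + 1) Y A) : ExtVanish E n Y X := by
  rw [extVanish_iff hE.proper] at *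
  intro Z hZ
  obtain ⟨K, P, i, q, hP, hq⟩ := hE.enoughProj Z
  exact .cone_right hE hc hP hq (hB Z hZ) (hA K (.succ i q hZ hP hq))

lemma ExtVanish.cocone_right (hE : IsProperWithEnough E) (hc : IsConflation E f g) {n : ℕ} {Y : C}
    (hX : ExtVanish E n Y X) (hB : ExtVanish E (n + 1) Y B) : ExtVanish E (n + 1) Y A := by
  rw [extVanish_iff hE.proper] at *
  rintro K (_ | ⟨i, q, hZ, hP, hq⟩)
  exact .cocone_right hE hc hP hq (hX _ hZ) (hB K (.succ i q hZ hP hq))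

lemma HasProjResolution.extVanish (hE : IsProperWithEnough E) {m : ℕ} {A : C}
    (h : HasProjResolution E m A) {n : ℕ} (hmn : m ≤ n) (Y : C) : ExtVanish E n A Y := by
  induction h generalizing n with
  | zero hP => exact .of_proj hE hP n Y
  | succ f g hP hc _ ih =>
    obtain ⟨n, rfl⟩ : ∃ k, n = k + 1 := ⟨n - 1, by omega⟩
    exact (extVanish_succ_iff_syzygy hE hP hc Y).2 (ih (by omega))

/-- Index `n` stands for `𝔼^(n+1)`. For `n = 0`, the obstruction to lifting `c` along a deflation is
`c ≫ δ`, a phantom map out of `A`, so `A` is projective; otherwise pass to a syzygy. -/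
lemma HasProjResolution.of_extVanish (hE : IsProperWithEnough E) {n : ℕ} {A : C}
    (h : ∀ Y, ExtVanish E n A Y) : HasProjResolution E n A := by
  induction n generalizing A with
  | zero =>
    refine .zero fun A' B X f g ⟨δ, hm⟩ c => dist_lift₃ (hE.proper.distinguished hm) c ?_
    exact (extVanish_zero_iff hE.proper).1 (h A') _
      (comp_mem_phantom hE.proper c (phantom_of_mem hm))
  | succ n ih =>
    obtain ⟨K, P, f, g, hP, hc⟩ := hE.enoughProj A
    exact .succ f g hP hc (ih fun Y => (extVanish_succ_iff_syzygy hE hP hc Y).1 (h Y))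

omit [Preadditive C] [HasZeroObject C] [∀ n : ℤ, (shiftFunctor C n).Additive]
  [Pretriangulated C] in
lemma HasProjResolution.projDim_le {n : ℕ} {A : C} (h : HasProjResolution E n A) :
    projDim E A ≤ n := iInf₂_le n h

omit [Preadditive C] [HasZeroObject C] [∀ n : ℤ, (shiftFunctor C n).Additive]
  [Pretriangulated C] in
lemma exists_hasProjResolution_of_projDim_le {n : ℕ} {A : C} (h : projDim E A ≤ n) :
    ∃ m ≤ n, HasProjResolution E m A := by
  by_contra! H
  have : ((n + 1 : ℕ) : ℕ∞) ≤ projDim E A := by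
    refine le_iInf₂ fun m hm => ?_
    by_contra hlt
    exact H m (by have := ENat.natCast_lt_natCast.1 (not_le.1 hlt); omega) hm
  have := ENat.natCast_le_natCast.1 (this.trans h)
  omega

end Ext

/-! ### Pullbacks, pushouts and composites of conflations via the octahedral axiom. -/

section Octahedra

variable [IsTriangulated C]

/-- The pullback of two deflations `B ⟶ X` and `F ⟶ X`. -/
lemma exists_conflation_pullback (hE : IsProperWithEnough E) {A B X D F : C} {f : A ⟶ B}
    {g : B ⟶ X} {d : D ⟶ F} {p : F ⟶ X} (hf : IsConflation E f g) (hd : IsConflation E d p) :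
    ∃ (U : C) (a : A ⟶ U) (u : U ⟶ F) (b : D ⟶ U) (w : U ⟶ B),
      IsConflation E a u ∧ IsConflation E b w := by
  obtain ⟨h, hm⟩ := hf
  obtain ⟨k, hk⟩ := hd
  obtain ⟨U, a, u, hu⟩ := comp_mem_phantom hE.proper p (phantom_of_mem hm)
  -- The octahedron on `p ≫ h` gives a triangle `D ⟶ U ⟶ B` with connecting map `g ≫ k`, a base
  -- change of `k`.
  have o := Triangulated.someOctahedron' rfl (hE.proper.distinguished hk)
    (rot_of_distTriang _ (hE.proper.distinguished hm))
    (rot_of_distTriang _ (hE.proper.distinguished hu))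
  exact ⟨U, a, u, o.m₁, o.m₃, ⟨_, hu⟩, _, mem_of_mem_phantom hE.proper o.mem
    (comp_mem_phantom hE.proper g (phantom_of_mem hk))⟩

/-- The pushout of two inflations `A ⟶ B` and `A ⟶ D`. -/
lemma exists_conflation_pushout (hE : IsProperWithEnough E) {A B X D F : C} {f : A ⟶ B}
    {g : B ⟶ X} {d : A ⟶ D} {p : D ⟶ F} (hf : IsConflation E f g) (hd : IsConflation E d p) :
    ∃ (U : C) (a : B ⟶ U) (u : U ⟶ F) (b : D ⟶ U) (w : U ⟶ X),
      IsConflation E a u ∧ IsConflation E b w := by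
  obtain ⟨h, hm⟩ := hf
  obtain ⟨k, hk⟩ := hd
  -- The octahedron is applied to the composite of `k` and `-f⟦1⟧'`; both signs come from rotating
  -- the triangles.
  have hkf : k ≫ (-f⟦(1 : ℤ)⟧') ∈ phantom E F B := by
    rw [Preadditive.comp_neg]
    exact neg_mem_phantom hE (comp_shift_mem_phantom hE.proper (phantom_of_mem hk) f)
  have hhd : h ≫ (-d⟦(1 : ℤ)⟧') ∈ phantom E X D := by
    rw [Preadditive.comp_neg]
    exact neg_mem_phantom hE (comp_shift_mem_phantom hE.proper (phantom_of_mem hm) d)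
  obtain ⟨U, a, u, hu⟩ := hkf
  have o := Triangulated.someOctahedron' rfl
    (rot_of_distTriang _ (hE.proper.distinguished hk))
    (rot_of_distTriang _ (rot_of_distTriang _ (hE.proper.distinguished hm)))
    (rot_of_distTriang _ (hE.proper.distinguished hu))
  exact ⟨U, a, u, o.m₁, o.m₃, ⟨_, hu⟩, _, mem_of_mem_phantom hE.proper o.mem hhd⟩

/-- The kernel of a composite of two deflations `T ⟶ Y` and `Y ⟶ W`. -/
lemma exists_conflation_comp (hE : IsProperWithEnough E) {L Y W Y' T : C} {l : L ⟶ Y}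
    {w : Y ⟶ W} {j : Y' ⟶ T} {q : T ⟶ Y} (hl : IsConflation E l w) (hj : IsConflation E j q) :
    ∃ (Z : C) (z : Z ⟶ T) (b : Y' ⟶ Z) (c : Z ⟶ L),
      IsConflation E z (q ≫ w) ∧ IsConflation E b c := by
  obtain ⟨h, hm⟩ := id hl
  obtain ⟨k, hk⟩ := id hj
  obtain ⟨Z, z, s, hz⟩ := distinguished_cocone_triangle₁ (q ≫ w)
  have o := Triangulated.someOctahedron' rfl (hE.proper.distinguished hk)
    (hE.proper.distinguished hm) hz
  refine ⟨Z, z, o.m₁, o.m₃, ⟨s, mem_of_mem_phantom hE.proper hz ?_⟩, _,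
    mem_of_mem_phantom hE.proper o.mem (comp_mem_phantom hE.proper l (phantom_of_mem hk))⟩
  -- A map from a projective to `W` lifts along `w` and then along `q`, so it factors through `q ≫
  -- w` and is killed by `s`.
  refine mem_phantom_of_proj hE fun P hP p => ?_
  obtain ⟨p, rfl⟩ := hP _ _ hl p
  obtain ⟨p, rfl⟩ := hP _ _ hj p
  have : (q ≫ w) ≫ s = 0 := comp_distTriang_mor_zero₂₃ _ hz
  rw [Category.assoc, Category.assoc, ← Category.assoc q, this, comp_zero]

end Octahedra

/-! ### Split conflations and retracts. -/

section Split

variable {A B X : C} {f : A ⟶ B} {g : B ⟶ X}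

lemma IsConflation.exists_retraction (hE : IsProperClass E) (hc : IsConflation E f g)
    (h : PhantomVanish E X A) : ∃ r : B ⟶ A, f ≫ r = 𝟙 A := by
  obtain ⟨δ, hm⟩ := hc
  exact dist_desc₁ (hE.distinguished hm) (𝟙 A) (by rw [h δ (phantom_of_mem hm), zero_comp])

lemma IsConflation.exists_section (hE : IsProperClass E) (hc : IsConflation E f g)
    (h : PhantomVanish E X A) : ∃ s : X ⟶ B, s ≫ g = 𝟙 X := by
  obtain ⟨δ, hm⟩ := hc
  exact dist_lift₃ (hE.distinguished hm) (𝟙 X) (by rw [h δ (phantom_of_mem hm), comp_zero])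

lemma isConflation_biprod (hE : IsProperClass E) (X Y : C) :
    IsConflation E (biprod.inl : X ⟶ X ⊞ Y) biprod.snd :=
  ⟨0, hE.split _ (binaryBiproductTriangle_distinguished X Y) rfl⟩

/-- Retracts are biproduct summands in a triangulated category: a split monomorphism has zero
connecting map. -/
lemma ClosedUnderSummands.of_retract {𝒳 : ObjectProperty C} (hs : ClosedUnderSummands 𝒳)
    (hi : 𝒳.IsClosedUnderIsomorphisms) (i : A ⟶ X) (r : X ⟶ A) (hir : i ≫ r = 𝟙 A)
    (hX : 𝒳 X) : 𝒳 A := by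
  obtain ⟨Z, p, δ, hT⟩ := distinguished_cocone_triangle i
  have h₀ : δ ≫ i⟦(1 : ℤ)⟧' = 0 := comp_distTriang_mor_zero₃₁ _ hT
  have h₁ : δ = 0 := by
    rw [← Category.comp_id δ, ← (shiftFunctor C (1 : ℤ)).map_id A, ← hir, Functor.map_comp,
      ← Category.assoc, h₀, zero_comp]
  obtain ⟨e, -⟩ := exists_iso_binaryBiproduct_of_distTriang _ hT h₁
  exact hs A Z (hi.of_iso e hX)

end Split

/-! ### Left minimal approximations in Krull-Schmidt categories. -/

section Minimal

omit [HasZeroObject C] [HasShift C ℤ] [∀ n : ℤ, (shiftFunctor C n).Additive]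
  [Pretriangulated C] in
-- The endomorphism is `x` on the summand `Y` and the identity on the kernel of `π`. It is
-- triangular with diagonal entry `x ≫ π`, so invertible when that entry is.
lemma isIso_id_add_comp {X Y : C} (π : X ⟶ Y) (ι x : Y ⟶ X) (hιπ : ι ≫ π = 𝟙 Y)
    (hx : IsIso (x ≫ π)) : IsIso (𝟙 X + π ≫ (x - ι)) := by
  obtain ⟨v, h₁, h₂⟩ := hx
  have h₁' : x ≫ π ≫ v = 𝟙 Y := by rw [← h₁, Category.assoc]
  have h₂' : ∀ {W : C} (c : Y ⟶ W), v ≫ x ≫ π ≫ c = c := fun c => by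
    rw [← Category.assoc x, ← Category.assoc v, h₂, Category.id_comp]
  have h₁'' : ∀ {W : C} (c : Y ⟶ W), x ≫ π ≫ v ≫ c = c := fun c => by
    rw [← Category.assoc π, ← Category.assoc x, h₁', Category.id_comp]
  have h₃ : ∀ {W : C} (c : Y ⟶ W), ι ≫ π ≫ c = c := fun c => by
    rw [← Category.assoc, hιπ, Category.id_comp]
  refine ⟨𝟙 X - π ≫ v ≫ (x - ι), ?_, ?_⟩
  · simp only [Preadditive.add_comp, Preadditive.comp_sub, Preadditive.sub_comp,
      Category.assoc, Category.id_comp, Category.comp_id, h₁'', h₃]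
    abel
  · simp only [Preadditive.comp_add, Preadditive.comp_sub, Preadditive.sub_comp,
      Category.assoc, Category.id_comp, Category.comp_id, h₂', h₃]
    abel

/-- A left `𝒳`-approximation of `B`. -/
def IsLeftApprox (𝒳 : ObjectProperty C) {B X₀ : C} (g : B ⟶ X₀) : Prop :=
  𝒳 X₀ ∧ ∀ X, 𝒳 X → ∀ h : B ⟶ X, ∃ k : X₀ ⟶ X, g ≫ k = h

omit [Preadditive C] [HasZeroObject C] [HasShift C ℤ] [∀ n : ℤ, (shiftFunctor C n).Additive]
  [Pretriangulated C] in
lemma IsLeftApprox.comp_iso {𝒳 : ObjectProperty C} (hi : 𝒳.IsClosedUnderIsomorphisms)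
    {B X₀ X₁ : C} {g : B ⟶ X₀} (hg : IsLeftApprox 𝒳 g) (e : X₀ ≅ X₁) :
    IsLeftApprox 𝒳 (g ≫ e.hom) := by
  refine ⟨hi.of_iso e hg.1, fun X hX h => ?_⟩
  obtain ⟨k, rfl⟩ := hg.2 X hX h
  exact ⟨e.inv ≫ k, by simp⟩

/-- If a summand `Y i` of a left approximation `⨁ Y` is split off by a map that vanishes on `B`,
then it can be removed. -/
lemma IsLeftApprox.remove_summand {𝒳 : ObjectProperty C} (hi : 𝒳.IsClosedUnderIsomorphisms)
    (hs : ClosedUnderSummands 𝒳) {B : C} {m : ℕ} {Y : Fin (m + 1) → C} {g : B ⟶ ⨁ Y}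
    (hg : IsLeftApprox 𝒳 g) (i : Fin (m + 1)) (a : ⨁ Y ⟶ Y i) (hga : g ≫ a = 0)
    (ha : biproduct.ι Y i ≫ a = 𝟙 _) :
    IsLeftApprox 𝒳
      (g ≫ biproduct.lift (f := fun j => Y (i.succAbove j)) fun _ => biproduct.π Y _) := by
  set p : ⨁ Y ⟶ ⨁ fun j => Y (i.succAbove j) := biproduct.lift fun j => biproduct.π Y _
  let q : (⨁ fun j => Y (i.succAbove j)) ⟶ ⨁ Y := biproduct.desc fun j => biproduct.ι Y _
  have hqp : q ≫ p = 𝟙 _ := by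
    ext j k
    by_cases hjk : j = k
    · subst hjk
      simp [p, q]
    · simp [p, q, biproduct.ι_π_ne _ (Ne.symm hjk), biproduct.ι_π_ne Y
        (fun h => hjk (Fin.succAbove_right_injective h).symm : i.succAbove k ≠ i.succAbove j)]
  have hpq : biproduct.π Y i ≫ biproduct.ι Y i + p ≫ q = 𝟙 _ := by
    rw [biproduct.lift_desc, ← Fin.sum_univ_succAbove
      (fun j => biproduct.π Y j ≫ biproduct.ι Y j) i, biproduct.total]
  -- The endomorphism `𝟙 - a ≫ ι` fixes `g` and kills the `i`-th summand, so nothing is lost when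
  -- `g` is projected to the other summands.
  have hgpq : g ≫ p ≫ q ≫ (𝟙 _ - a ≫ biproduct.ι Y i) = g := by
    have h₁ : biproduct.ι Y i ≫ (𝟙 _ - a ≫ biproduct.ι Y i) = 0 := by
      rw [Preadditive.comp_sub, ← Category.assoc, ha]
      simp
    have h₂ : p ≫ q ≫ (𝟙 _ - a ≫ biproduct.ι Y i) = 𝟙 _ - a ≫ biproduct.ι Y i := by
      rw [← Category.assoc, ← sub_eq_of_eq_add' hpq.symm, Preadditive.sub_comp, Category.assoc, h₁]
      simp
    rw [h₂, Preadditive.comp_sub, ← Category.assoc, hga]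
    simp
  refine ⟨hs.of_retract hi q p hqp hg.1, fun X hX h => ?_⟩
  obtain ⟨k, rfl⟩ := hg.2 X hX h
  refine ⟨q ≫ (𝟙 _ - a ≫ biproduct.ι Y i) ≫ k, ?_⟩
  conv_rhs => rw [← hgpq]
  simp only [Category.assoc]

/-- In a Krull-Schmidt category, left approximations can be chosen left minimal. -/
lemma exists_minimal_leftApprox (hC : IsKrullSchmidt C) {𝒳 : ObjectProperty C}
    (hi : 𝒳.IsClosedUnderIsomorphisms) (hs : ClosedUnderSummands 𝒳)
    (hc : IsCovariantlyFinite 𝒳) (B : C) :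
    ∃ (X₀ : C) (g : B ⟶ X₀), IsLeftApprox 𝒳 g ∧ ∀ t : X₀ ⟶ X₀, g ≫ t = g → IsIso t := by
  classical
  -- Minimality is obtained by taking the fewest indecomposable summands.
  have hex : ∃ m : ℕ, ∃ Y : Fin m → C, (∀ i, IsLocalRing (End (Y i))) ∧
      ∃ g : B ⟶ ⨁ Y, IsLeftApprox 𝒳 g := by
    obtain ⟨X₀, g, hX₀, hg⟩ := hc B
    obtain ⟨m, Y, hY, ⟨e⟩⟩ := hC X₀
    exact ⟨m, Y, hY, g ≫ e.hom, IsLeftApprox.comp_iso hi ⟨hX₀, hg⟩ e⟩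
  obtain ⟨Y, hY, g, hg⟩ := Nat.find_spec hex
  have hmin := fun m hm => Nat.find_min hex (m := m) hm
  generalize Nat.find hex = m at *
  refine ⟨_, g, hg, fun t ht => ?_⟩
  -- Otherwise a summand could be removed, contradicting the choice of `m`. The automorphism `φ`
  -- allows any decomposition obtained from the given one by an automorphism.
  have key : ∀ (φ : ⨁ Y ⟶ ⨁ Y) [IsIso φ] (i : Fin m) (a : ⨁ Y ⟶ Y i), g ≫ a = 0 →
      ¬ IsIso (biproduct.ι Y i ≫ φ ≫ a) := by
    intro φ _ i a hga hiso
    obtain ⟨m, rfl⟩ : ∃ k, m = k + 1 := ⟨m - 1, by have := i.2; omega⟩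
    have := IsLeftApprox.remove_summand hi hs (hg.comp_iso hi (asIso φ).symm) i
      (φ ≫ a ≫ inv (biproduct.ι Y i ≫ φ ≫ a))
      (by
        simp only [Iso.symm_hom, asIso_inv, Category.assoc, IsIso.inv_hom_id_assoc]
        rw [← Category.assoc, hga, zero_comp])
      (by
        have := IsIso.hom_inv_id (biproduct.ι Y i ≫ φ ≫ a)
        simpa only [Category.assoc] using this)
    exact hmin m (Nat.lt_succ_self m) ⟨_, fun j => hY _, _, this⟩
  -- `Φ S` interpolates between the identity and `t`, which are compared one summand at a time.
  let Φ : Finset (Fin m) → (⨁ Y ⟶ ⨁ Y) := fun S =>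
    biproduct.desc fun i => if i ∈ S then biproduct.ι Y i ≫ t else biproduct.ι Y i
  have hΦ : ∀ S, IsIso (Φ S) := by
    intro S
    induction S using Finset.induction_on with
    | empty =>
      have : Φ ∅ = 𝟙 _ := biproduct.hom_ext' _ _ fun j => by simp [Φ]
      rw [this]
      infer_instance
    | insert i S hiS ih =>
      have h₁ : biproduct.ι Y i ≫ Φ S = biproduct.ι Y i := by simp [Φ, hiS]
      have h₂ : biproduct.ι Y i ≫ inv (Φ S) = biproduct.ι Y i := by
        rw [IsIso.comp_inv_eq, h₁]
      have h₃ := key (Φ S) i ((𝟙 _ - t) ≫ inv (Φ S) ≫ biproduct.π Y i)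
        (by rw [← Category.assoc, Preadditive.comp_sub, ht]; simp)
      -- Two elements of a local ring with sum one: `h₃` excludes that the first is a unit, so the
      -- second is.
      have h₄ : (biproduct.ι Y i ≫ Φ S ≫ (𝟙 _ - t) ≫ inv (Φ S) ≫ biproduct.π Y i) +
          (biproduct.ι Y i ≫ t ≫ inv (Φ S)) ≫ biproduct.π Y i = 𝟙 (Y i) := by
        rw [← Category.assoc (biproduct.ι Y i) (Φ S), h₁]
        simp only [Preadditive.sub_comp, Preadditive.comp_sub, Category.id_comp, Category.assoc]
        rw [← Category.assoc (biproduct.ι Y i) (inv _), h₂]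
        simp
      have h₅ : IsIso ((biproduct.ι Y i ≫ t ≫ inv (Φ S)) ≫ biproduct.π Y i) := by
        have := hY i
        rcases IsLocalRing.isUnit_or_isUnit_of_add_one (R := End (Y i)) h₄ with h | h
        · exact absurd ((isUnit_iff_isIso _).1 h) h₃
        · exact (isUnit_iff_isIso _).1 h
      have h₆ := isIso_id_add_comp (biproduct.π Y i) (biproduct.ι Y i) _ (by simp) h₅
      have h₇ : Φ (insert i S) = (𝟙 _ + biproduct.π Y i ≫
          (biproduct.ι Y i ≫ t ≫ inv (Φ S) - biproduct.ι Y i)) ≫ Φ S := by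
        refine biproduct.hom_ext' _ _ fun j => ?_
        rw [Preadditive.add_comp, Category.id_comp, Preadditive.comp_add, Category.assoc]
        by_cases hij : j = i
        · subst hij
          rw [biproduct.ι_π_self_assoc, Preadditive.sub_comp, h₁]
          simp [Φ]
        · rw [biproduct.ι_π_ne_assoc _ hij, zero_comp, add_zero]
          simp [Φ, hij]
      rw [h₇]
      infer_instance
  have : Φ Finset.univ = t := biproduct.hom_ext' _ _ fun j => by simp [Φ]
  rw [← this]
  exact hΦ _

end Minimal

variable {𝒳 𝒯 : ObjectProperty C} {n : ℕ}

open ZeroObject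

/-! ### Closure properties of the orthogonals. -/

section Perp

lemma ExtVanish.of_isZero_left (hE : IsProperWithEnough E) {Z : C} (hZ : IsZero Z) (i : ℕ) (Y : C) :
    ExtVanish E i Z Y := by
  refine .of_proj hE (fun A B X f g _ c => ⟨0, ?_⟩) i Y
  rw [zero_comp, hZ.eq_of_src c 0]

lemma ExtVanish.of_isZero_right (hE : IsProperWithEnough E) {Z : C} (hZ : IsZero Z) (i : ℕ)
    (X : C) : ExtVanish E i X Z := by
  refine .of_inj hE (fun A B X f g _ c => ⟨0, ?_⟩) i X
  rw [comp_zero, hZ.eq_of_tgt c 0]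

lemma rightPerp_isAdditiveSubcategory (hE : IsProperWithEnough E) (𝒯 : ObjectProperty C) :
    IsAdditiveSubcategory (rightPerp E 𝒯) where
  iso := ⟨fun e hX T hT i => (hX T hT i).of_retract_right hE e.inv e.hom e.inv_hom_id⟩
  zero := ⟨0, isZero_zero C, fun T _ i => .of_isZero_right hE (isZero_zero C) i T⟩
  biprod X Y hX hY T hT i :=
    .middle_right hE (isConflation_biprod hE.proper X Y) (hX T hT i) (hY T hT i)

lemma leftPerp_isAdditiveSubcategory (hE : IsProperWithEnough E) (𝒯 : ObjectProperty C) :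
    IsAdditiveSubcategory (leftPerp E 𝒯) where
  iso := ⟨fun e hX T hT i => (hX T hT i).of_retract_left hE e.inv e.hom e.inv_hom_id⟩
  zero := ⟨0, isZero_zero C, fun T _ i => .of_isZero_left hE (isZero_zero C) i T⟩
  biprod X Y hX hY T hT i :=
    .middle_left hE (isConflation_biprod hE.proper X Y) (hX T hT i) (hY T hT i)

lemma IsAdditiveSubcategory.inf (h𝒳 : IsAdditiveSubcategory 𝒳) (h𝒯 : IsAdditiveSubcategory 𝒯) :
    IsAdditiveSubcategory (𝒳 ⊓ 𝒯) where
  iso := ⟨fun e hX => ⟨h𝒳.iso.of_iso e hX.1, h𝒯.iso.of_iso e hX.2⟩⟩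
  zero := by
    obtain ⟨Z, hZ, h⟩ := h𝒳.zero
    obtain ⟨Z', hZ', h'⟩ := h𝒯.zero
    exact ⟨Z, hZ, h, h𝒯.iso.of_iso (hZ'.iso hZ) h'⟩
  biprod X Y hX hY := ⟨h𝒳.biprod X Y hX.1 hY.1, h𝒯.biprod X Y hX.2 hY.2⟩

lemma rightPerp_closedUnderSummands (hE : IsProperWithEnough E) (𝒯 : ObjectProperty C) :
    ClosedUnderSummands (rightPerp E 𝒯) := fun _ _ h T hT i =>
  (h T hT i).of_retract_right hE biprod.inl biprod.fst biprod.inl_fst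

lemma leftPerp_closedUnderSummands (hE : IsProperWithEnough E) (𝒯 : ObjectProperty C) :
    ClosedUnderSummands (leftPerp E 𝒯) := fun _ _ h T hT i =>
  (h T hT i).of_retract_left hE biprod.inl biprod.fst biprod.inl_fst

lemma rightPerp_isCoresolving (hE : IsProperWithEnough E) (𝒯 : ObjectProperty C) :
    IsCoresolving E (rightPerp E 𝒯) where
  inj_le _ hI T _ i := .of_inj hE hI i T
  ext _ _ hc hA hX T hT i := .middle_right hE hc (hA T hT i) (hX T hT i)
  cone _ _ hc hA hB T hT i := .cone_right hE hc (hB T hT i) (hA T hT (i + 1))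

omit [HasZeroObject C] [∀ n : ℤ, (shiftFunctor C n).Additive] [Pretriangulated C] in
lemma le_leftPerp_rightPerp (𝒯 : ObjectProperty C) : 𝒯 ≤ leftPerp E (rightPerp E 𝒯) :=
  fun T hT _ hY i => hY T hT i

lemma leftPerp_cocone (hE : IsProperWithEnough E) {A B X : C} {f : A ⟶ B} {g : B ⟶ X}
    (hc : IsConflation E f g) (hB : leftPerp E 𝒳 B) (hX : leftPerp E 𝒳 X) : leftPerp E 𝒳 A :=
  fun Y hY i => .cocone_left hE hc (hB Y hY i) (hX Y hY (i + 1))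

lemma leftPerp_middle (hE : IsProperWithEnough E) {A B X : C} {f : A ⟶ B} {g : B ⟶ X}
    (hc : IsConflation E f g) (hA : leftPerp E 𝒳 A) (hX : leftPerp E 𝒳 X) : leftPerp E 𝒳 B :=
  fun Y hY i => .middle_left hE hc (hA Y hY i) (hX Y hY i)

lemma leftPerp_of_proj (hE : IsProperWithEnough E) {P : C} (hP : proj E P) : leftPerp E 𝒳 P :=
  fun Y _ i => .of_proj hE hP i Y

/-- For a coresolving subcategory it suffices to check the vanishing of first extensions. -/
lemma IsCoresolving.leftPerp_of_phantomVanish (hE : IsProperWithEnough E)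
    (h𝒳 : IsCoresolving E 𝒳) {W : C} (hW : ∀ X, 𝒳 X → PhantomVanish E W X) :
    leftPerp E 𝒳 W := by
  intro X hX i
  induction i generalizing X with
  | zero => exact (extVanish_zero_iff hE.proper).2 (hW X hX)
  | succ i ih =>
    obtain ⟨I, L, f, g, hI, hc⟩ := hE.enoughInj X
    exact (extVanish_succ_iff_cosyzygy hE W hI hc).2
      (ih L (h𝒳.cone f g hc hX (h𝒳.inj_le I hI)))

lemma phantomVanish_of_leftPerp (hE : IsProperWithEnough E) {W X : C} (hW : leftPerp E 𝒳 W)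
    (hX : 𝒳 X) : PhantomVanish E W X :=
  (extVanish_zero_iff hE.proper).1 (hW X hX 0)

end Perp

/-! ### Special approximations: Wakamatsu and Auslander-Buchweitz. -/

section Approximation

variable (E) in
/-- Every object has a left `𝒳`-approximation that is an inflation with cokernel
in `leftPerp 𝒳`. -/
def HasSpecialApprox (𝒳 : ObjectProperty C) : Prop :=
  ∀ A : C, ∃ (U W : C) (a : A ⟶ U) (b : U ⟶ W), IsConflation E a b ∧ 𝒳 U ∧ leftPerp E 𝒳 W

lemma HasSpecialApprox.isCovariantlyFinite (hE : IsProperWithEnough E)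
    (h : HasSpecialApprox E 𝒳) : IsCovariantlyFinite 𝒳 := by
  intro B
  obtain ⟨U, W, a, b, ⟨δ, hm⟩, hU, hW⟩ := h B
  refine ⟨U, a, hU, fun X hX c => dist_desc₁ (hE.proper.distinguished hm) c ?_⟩
  exact phantomVanish_of_leftPerp hE hW hX _
    (comp_shift_mem_phantom hE.proper (phantom_of_mem hm) c)

/-- Wakamatsu's lemma: the cokernel of a minimal left approximation is in the left orthogonal. -/
lemma hasSpecialApprox_of_covariantlyFinite (hE : IsProperWithEnough E) (hC : IsKrullSchmidt C)
    (hi : 𝒳.IsClosedUnderIsomorphisms) (hs : ClosedUnderSummands 𝒳)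
    (hr : IsCoresolving E 𝒳) (hc : IsCovariantlyFinite 𝒳) : HasSpecialApprox E 𝒳 := by
  intro A
  obtain ⟨U, g, ⟨hU, hg⟩, hmin⟩ := exists_minimal_leftApprox hC hi hs hc A
  obtain ⟨W, b, δ, hT⟩ := distinguished_cocone_triangle g
  have hδ : δ ≫ g⟦(1 : ℤ)⟧' = 0 := comp_distTriang_mor_zero₃₁ _ hT
  have hgb : g ≫ b = 0 := comp_distTriang_mor_zero₁₂ _ hT
  have hδ' : ∀ X, 𝒳 X → ∀ c : A ⟶ X, δ ≫ c⟦(1 : ℤ)⟧' = 0 := by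
    intro X hX c
    obtain ⟨k, rfl⟩ := hg X hX c
    rw [Functor.map_comp, ← Category.assoc, hδ, zero_comp]
  -- The approximation is an inflation because `𝒳` contains the injectives, so every map from `A` to
  -- an injective factors through `g`.
  have hm : Triangle.mk g b δ ∈ E := mem_of_mem_phantom hE.proper hT
    (mem_phantom_of_inj hE fun I hI j => hδ' I (hr.inj_le I hI) j)
  refine ⟨U, W, g, b, ⟨δ, hm⟩, hU, hr.leftPerp_of_phantomVanish hE fun X hX h hh => ?_⟩
  -- The pulled-back extension `Q` of `U` by `X` lies in `𝒳`. Since `g` lifts to `Q`, the lift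
  -- extends to `s : U ⟶ Q`, and `s ≫ q` fixes `g`. By minimality it is invertible, so the extension
  -- splits.
  have hbh : b ≫ h = 0 := by
    obtain ⟨Q, j, q, hQ⟩ := comp_mem_phantom hE.proper b hh
    have hQd := hE.proper.distinguished hQ
    obtain ⟨g', hg'⟩ := dist_lift₃ hQd g (by rw [← Category.assoc, hgb, zero_comp])
    obtain ⟨s, hs⟩ := hg Q (hr.ext j q ⟨_, hQ⟩ hX hU) g'
    have := hmin (s ≫ q) (by rw [← Category.assoc, hs, hg'])
    have hq : q ≫ b ≫ h = 0 := comp_distTriang_mor_zero₂₃ _ hQd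
    rw [← cancel_epi (s ≫ q), Category.assoc, hq, comp_zero, comp_zero]
  obtain ⟨c, rfl⟩ := dist_desc₃ hT h hbh
  exact hδ' X hX c

/-- The Auslander-Buchweitz approximation. -/
lemma exists_approx_of_coresolved [IsTriangulated C] (hE : IsProperWithEnough E)
    (hr : IsCoresolving E 𝒳) (hg : ∀ X, 𝒳 X → ∃ (X' T : C) (f : X' ⟶ T) (g : T ⟶ X),
      leftPerp E 𝒳 T ∧ 𝒳 X' ∧ IsConflation E f g)
    {m : ℕ} {A : C} (hA : coresolved E 𝒳 m A) :
    ∃ (U W : C) (a : A ⟶ U) (b : U ⟶ W), IsConflation E a b ∧ 𝒳 U ∧ leftPerp E 𝒳 W := by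
  induction m generalizing A with
  | zero =>
    refine ⟨A, 0, 𝟙 A, 0, ⟨0, ?_⟩, hA, fun X _ i => .of_isZero_left hE (isZero_zero C) i X⟩
    exact hE.proper.split _ (contractible_distinguished A) rfl
  | succ m ih =>
    obtain ⟨Y₀, L, f, g, hY₀, hc, hL⟩ := hA
    obtain ⟨Y₁, W₁, l, w, hl, hY₁, hW₁⟩ := ih hL
    -- `Y₁` is replaced by `T` in `leftPerp 𝒳`: the kernel `Z` of `T ⟶ Y₁ ⟶ W₁` is then in `leftPerp
    -- 𝒳` and is an extension of `L` by `Y'`. Pulling back `Y₀ ⟶ L` along `Z ⟶ L` gives `U`, an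
    -- extension of `Y₀` by `Y'`.
    obtain ⟨Y', T, j, q, hT, hY', hj⟩ := hg Y₁ hY₁
    obtain ⟨Z, z, b, c, hz, hb⟩ := exists_conflation_comp hE hl hj
    obtain ⟨U, a, u, b', w', ha, hb'⟩ := exists_conflation_pullback hE hc hb
    exact ⟨U, Z, a, u, ha, hr.ext _ _ hb' hY' hY₀, leftPerp_cocone hE hz hT hW₁⟩

end Approximation

/-! ### From tilting to coresolving subcategories. -/

section Tilting

lemma IsTilting.extVanish (hE : IsProperWithEnough E) (h : IsTilting E n 𝒯) {T : C} (hT : 𝒯 T)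
    {i : ℕ} (hi : n ≤ i) (Y : C) : ExtVanish E i T Y := by
  obtain ⟨m, hm, hres⟩ := exists_hasProjResolution_of_projDim_le (h.projDim_le T hT)
  exact hres.extVanish hE (hm.trans hi) Y

/-- Use injectives for the first `m` terms; by dimension shift the `m`-th cosyzygy lies in the
orthogonal. -/
lemma coresolved_rightPerp (hE : IsProperWithEnough E) {m : ℕ} {A : C}
    (h : ∀ T, 𝒯 T → ∀ i, m ≤ i → ExtVanish E i T A) : coresolved E (rightPerp E 𝒯) m A := by
  induction m generalizing A with
  | zero => exact fun T hT i => h T hT i (Nat.zero_le i)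
  | succ m ih =>
    obtain ⟨I, L, f, g, hI, hc⟩ := hE.enoughInj A
    exact ⟨I, L, f, g, (rightPerp_isCoresolving hE 𝒯).inj_le I hI, hc, ih fun T hT i hi =>
      (extVanish_succ_iff_cosyzygy hE T hI hc).1 (h T hT (i + 1) (by omega))⟩

lemma IsTilting.isCoresolvingCovFinite_rightPerp [IsTriangulated C]
    (hE : IsProperWithEnough E) (h : IsTilting E n 𝒯) : IsCoresolvingCovFinite E n (rightPerp E 𝒯) := by
  have hco : coresolved E (rightPerp E 𝒯) n = ⊤ :=
    top_le_iff.1 fun A _ => coresolved_rightPerp hE fun T hT i hi => h.extVanish hE hT hi A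
  have hr := rightPerp_isCoresolving hE 𝒯
  refine ⟨rightPerp_isAdditiveSubcategory hE 𝒯, hr, HasSpecialApprox.isCovariantlyFinite hE fun A => ?_,
    rightPerp_closedUnderSummands hE 𝒯, hco⟩
  refine exists_approx_of_coresolved hE hr (fun X hX => ?_)
    (hco ▸ trivial : coresolved E (rightPerp E 𝒯) n A)
  obtain ⟨X', T, f, g, hT, hX', hc⟩ := h.generator.2 X hX
  exact ⟨X', T, f, g, le_leftPerp_rightPerp 𝒯 T hT, hX', hc⟩

/-- For `Y` in the intersection, the generator triangle `Y' ⟶ T ⟶ Y` splits, so `Y` is a summand of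
`T`. -/
lemma IsTilting.leftPerp_rightPerp_inf (hE : IsProperWithEnough E) (h : IsTilting E n 𝒯) :
    leftPerp E (rightPerp E 𝒯) ⊓ rightPerp E 𝒯 = 𝒯 := by
  refine le_antisymm (fun Y hY => ?_) fun T hT =>
    ⟨le_leftPerp_rightPerp 𝒯 T hT, h.generator.1 T hT⟩
  obtain ⟨Y', T, f, g, hT, hY', hc⟩ := h.generator.2 Y hY.2
  obtain ⟨s, hs⟩ := hc.exists_section hE.proper (phantomVanish_of_leftPerp hE hY.1 hY')
  exact h.summands.of_retract h.additive.iso s g hs hT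

end Tilting

/-! ### From coresolving to tilting subcategories. -/

section Coresolving

/-- Dimension shift along the coresolution moves `𝔼^(m+1)(Z, A)` to a first extension by its last
term. -/
lemma extVanish_of_coresolved (hE : IsProperWithEnough E) {Z : C} (hZ : leftPerp E 𝒳 Z) {m : ℕ}
    {A : C} (hA : coresolved E 𝒳 m A) : ExtVanish E m Z A := by
  induction m generalizing A with
  | zero => exact hZ A hA 0
  | succ m ih =>
    obtain ⟨X, L, f, g, hX, hc, hL⟩ := hA
    exact .cocone_right hE hc (ih hL) (hZ X hX (m + 1))

lemma leftPerp_of_coresolved (hE : IsProperWithEnough E) {𝒴 : ObjectProperty C}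
    (h𝒯 : 𝒯 ≤ leftPerp E 𝒴) {m : ℕ} {A : C} (hA : coresolved E 𝒯 m A) : leftPerp E 𝒴 A := by
  induction m generalizing A with
  | zero => exact h𝒯 A hA
  | succ m ih =>
    obtain ⟨X, L, f, g, hX, hc, hL⟩ := hA
    exact leftPerp_cocone hE hc (h𝒯 X hX) (ih hL)

/-- In `W ⟶ U ⟶ W'` the middle term is again in `leftPerp 𝒳`, and each step lowers the degree of the
vanishing hypothesis by one. In degree zero the triangle splits and `W` itself lies in `𝒳`. -/
lemma HasSpecialApprox.coresolved_of_leftPerp (hE : IsProperWithEnough E)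
    (ha : HasSpecialApprox E 𝒳) (hi : 𝒳.IsClosedUnderIsomorphisms) (hs : ClosedUnderSummands 𝒳)
    {m : ℕ} {W : C} (hW : leftPerp E 𝒳 W) (hm : ∀ Z, leftPerp E 𝒳 Z → ExtVanish E m Z W) :
    coresolved E (leftPerp E 𝒳 ⊓ 𝒳) m W := by
  induction m generalizing W with
  | zero =>
    obtain ⟨U, W', a, b, hc, hU, hW'⟩ := ha W
    obtain ⟨r, hr⟩ := hc.exists_retraction hE.proper
      ((extVanish_zero_iff hE.proper).1 (hm W' hW'))
    exact ⟨hW, hs.of_retract hi a r hr hU⟩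
  | succ m ih =>
    obtain ⟨U, W', a, b, hc, hU, hW'⟩ := ha W
    exact ⟨U, W', a, b, ⟨leftPerp_middle hE hc hW hW', hU⟩, hc, ih hW' fun Z hZ =>
      .cone_right hE hc (hZ U hU m) (hm Z hZ)⟩

variable (hE : IsProperWithEnough E) (hC : IsKrullSchmidt C) (h : IsCoresolvingCovFinite E n 𝒳)
include hE h

lemma IsCoresolvingCovFinite.extVanish {Z : C} (hZ : leftPerp E 𝒳 Z) (Y : C) :
    ExtVanish E n Z Y :=
  extVanish_of_coresolved hE hZ (by rw [h.coresolved_eq]; trivial)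

include hC

lemma IsCoresolvingCovFinite.hasSpecialApprox : HasSpecialApprox E 𝒳 :=
  hasSpecialApprox_of_covariantlyFinite hE hC h.additive.iso h.summands h.coresolving h.covFinite

lemma IsCoresolvingCovFinite.rightPerp_leftPerp_inf :
    rightPerp E (leftPerp E 𝒳 ⊓ 𝒳) = 𝒳 := by
  refine le_antisymm (fun Y hY => ?_) fun X hX T hT i => hT.1 X hX i
  have ha := h.hasSpecialApprox hE hC
  obtain ⟨U, W, a, b, hc, hU, hW⟩ := ha Y
  -- The finite coresolution of `W` makes it left orthogonal to everything in `rightPerp` of the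
  -- intersection, in particular to `Y`; so `Y ⟶ U` splits.
  have hco := ha.coresolved_of_leftPerp hE h.additive.iso h.summands hW
    fun Z hZ => h.extVanish hE hZ W
  have hW' := leftPerp_of_coresolved hE (le_leftPerp_rightPerp (E := E) _) hco
  obtain ⟨r, hr⟩ := hc.exists_retraction hE.proper (phantomVanish_of_leftPerp hE hW' hY)
  exact h.summands.of_retract h.additive.iso a r hr hU

lemma IsCoresolvingCovFinite.isTilting [IsTriangulated C] :
    IsTilting E n (leftPerp E 𝒳 ⊓ 𝒳) where
  additive := (leftPerp_isAdditiveSubcategory hE 𝒳).inf h.additive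
  summands X Y hXY :=
    ⟨leftPerp_closedUnderSummands hE 𝒳 X Y hXY.1, h.summands X Y hXY.2⟩
  projDim_le T hT :=
    (HasProjResolution.of_extVanish hE fun Y => h.extVanish hE hT.1 Y).projDim_le
  generator := by
    rw [h.rightPerp_leftPerp_inf hE hC]
    refine ⟨inf_le_right, fun X hX => ?_⟩
    -- Pushing out `K ⟶ P` along the special approximation `K ⟶ V` gives `U`. It is an extension of
    -- `W` by `P`, hence in `leftPerp 𝒳`, and of `X` by `V`, hence in `𝒳`.
    obtain ⟨K, P, f, g, hP, hc⟩ := hE.enoughProj X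
    obtain ⟨V, W, a, b, hab, hV, hW⟩ := h.hasSpecialApprox hE hC K
    obtain ⟨U, a', u, b', w, ha', hb'⟩ := exists_conflation_pushout hE hc hab
    exact ⟨V, U, b', w, ⟨leftPerp_middle hE ha' (leftPerp_of_proj hE hP) hW,
      h.coresolving.ext _ _ hb' hV hX⟩, hV, hb'⟩

end Coresolving

end ProperTilting

/-! ### The bijection. -/

theorem theorem5p12 {C : Type*} [Category* C] [Preadditive C] [HasZeroObject C] [HasShift C ℤ]
    [∀ n : ℤ, (shiftFunctor C n).Additive] [Pretriangulated C] [IsTriangulated C]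
    (hC : ProperTilting.IsKrullSchmidt C)
    (E : Set (Triangle C)) (hE : ProperTilting.IsProperClass E)
    (hP : ProperTilting.EnoughProj E) (hI : ProperTilting.EnoughInj E) (n : ℕ) :
    Set.BijOn (fun 𝒯 : ObjectProperty C => ProperTilting.rightPerp E 𝒯)
        {𝒯 | ProperTilting.IsTilting E n 𝒯} {𝒳 | ProperTilting.IsCoresolvingCovFinite E n 𝒳} ∧
      Set.BijOn (fun 𝒳 : ObjectProperty C => ProperTilting.leftPerp E 𝒳 ⊓ 𝒳)
        {𝒳 | ProperTilting.IsCoresolvingCovFinite E n 𝒳} {𝒯 | ProperTilting.IsTilting E n 𝒯} ∧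
      Set.InvOn (fun 𝒳 : ObjectProperty C => ProperTilting.leftPerp E 𝒳 ⊓ 𝒳)
        (fun 𝒯 : ObjectProperty C => ProperTilting.rightPerp E 𝒯)
        {𝒯 | ProperTilting.IsTilting E n 𝒯}
        {𝒳 | ProperTilting.IsCoresolvingCovFinite E n 𝒳} := by
  have hE' : ProperTilting.IsProperWithEnough E := ⟨hE, hP, hI⟩
  have hinv : Set.InvOn (fun 𝒳 : ObjectProperty C => ProperTilting.leftPerp E 𝒳 ⊓ 𝒳)
      (fun 𝒯 : ObjectProperty C => ProperTilting.rightPerp E 𝒯)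
      {𝒯 | ProperTilting.IsTilting E n 𝒯} {𝒳 | ProperTilting.IsCoresolvingCovFinite E n 𝒳} :=
    ⟨fun _ h => h.leftPerp_rightPerp_inf hE', fun _ h => h.rightPerp_leftPerp_inf hE' hC⟩
  have h₁ : Set.MapsTo (fun 𝒯 : ObjectProperty C => ProperTilting.rightPerp E 𝒯)
      {𝒯 | ProperTilting.IsTilting E n 𝒯} {𝒳 | ProperTilting.IsCoresolvingCovFinite E n 𝒳} :=
    fun _ h => h.isCoresolvingCovFinite_rightPerp hE'
  have h₂ : Set.MapsTo (fun 𝒳 : ObjectProperty C => ProperTilting.leftPerp E 𝒳 ⊓ 𝒳)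
      {𝒳 | ProperTilting.IsCoresolvingCovFinite E n 𝒳} {𝒯 | ProperTilting.IsTilting E n 𝒯} :=
    fun _ h => h.isTilting hE' hC
  exact ⟨hinv.bijOn h₁ h₂, hinv.symm.bijOn h₂ h₁, hinv⟩
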